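/- Let $q$ be a complex number with $|q|<1$, and write $(a;q)_n=\prod_{k=0}^{n-1}(1-aq^k)$ and $(a;q)_\infty=\lim_{n\to\infty}(a;q)_n$. Let $$\omega(q)=\sum_{n=0}^{\infty}\frac{q^{2n^2+2n}}{(q;q^2)_{n+1}^2}$$ be Ramanujan's third order mock theta function, and for $n\ge 1$ let $p_\omega(n)$ be the number of partitions of $n$ in which each odd part is less than twice the smallest part. Then all denominators here and below are nonzero, all the series converge absolutely, and $$\sum_{n=1}^{\infty}p_\omega(n)q^n=\sum_{n=1}^{\infty}\frac{q^n}{(1-q^n)(q^{n+1};q)_n(q^{2n+2};q^2)_\infty}=q\,\omega(q).$$ -/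

import Mathlib

open Filter Topology

noncomputable section

/-- The finite `q`-shifted factorial `(a; q)_n = ∏_{k=0}^{n-1} (1 - a q^k)`. -/
def qShifted (a q : ℂ) (n : ℕ) : ℂ :=
  ∏ k ∈ Finset.range n, (1 - a * q ^ k)

/-- The infinite `q`-shifted factorial `(a; q)_∞ = lim_{n → ∞} (a; q)_n`. -/
def qShiftedInf (a q : ℂ) : ℂ :=
  limUnder atTop (fun n : ℕ => qShifted a q n)

/-- Ramanujan's third order mock theta function
`ω(q) = ∑_{n ≥ 0} q^{2n^2+2n} / (q; q^2)_{n+1}^2`. -/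
def mockOmega (q : ℂ) : ℂ :=
  ∑' n : ℕ, q ^ (2 * n ^ 2 + 2 * n) / qShifted q (q ^ 2) (n + 1) ^ 2

/-- The smallest part of a partition of a positive integer. -/
def Nat.Partition.smallestPart {n : ℕ} (p : n.Partition) : ℕ :=
  sInf {j : ℕ | j ∈ p.parts}

/-- `p_ω(n)`: the number of partitions of `n` in which each odd part is less than twice the
smallest part. -/
def pOmega (n : ℕ) : ℕ :=
  Nat.card {p : n.Partition // ∀ i ∈ p.parts, Odd i → i < 2 * p.smallestPart}

/-- For `|q| < 1` the limit defining `(a; q)_∞` exists. -/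
theorem tendsto_qShifted (a q : ℂ) (hq : ‖q‖ < 1) :
    Tendsto (fun n : ℕ => qShifted a q n) atTop (𝓝 (qShiftedInf a q)) := by
  have hs : Summable (fun k : ℕ => ‖-(a * q ^ k)‖) := by
    simp only [norm_neg, norm_mul, norm_pow]
    exact (summable_geometric_of_lt_one (norm_nonneg q) hq).mul_left _
  have hm : Multipliable (fun k : ℕ => 1 + -(a * q ^ k)) :=
    multipliable_one_add_of_summable hs
  refine tendsto_nhds_limUnder ⟨∏' k : ℕ, (1 + -(a * q ^ k)), ?_⟩
  simpa only [qShifted, sub_eq_add_neg] using hm.hasProd.tendsto_prod_nat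

end

/-! The analytic half inserts a variable z. Let F(z) and G(z) be the sums of `partTerm q z` and
`omegaTerm q z`; at z = 1 they are the partition series and ω(q). Telescoping gives, for |z| ≤ 1,
the equations (1 - zq) F(z) = q + q F(zq²) and (1 - zq) G(z) = 1 + q G(zq²), so D = F - qG satisfies
(1 - zq) D(z) = q D(zq²). Iterating from z = 1 gives (q;q²)_m D(1) = q^m D(q^{2m}). Since D is
bounded on the closed unit disc and (q;q²)_m is bounded away from 0, D(1) = 0.

The combinatorial half sums q^|m| over all nonempty admissible partitions m. Grouping by size gives
the series of p_ω. Grouping by smallest part s and removing one copy of s leaves an arbitrary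
multiset of parts from {s, ..., 2s} ∪ {2s+2, 2s+4, ...}, whose generating function is the reciprocal
of the denominator. -/

/-! ### Finite and infinite q-products, with uniform lower bounds -/

theorem qShifted_succ (a q : ℂ) (n : ℕ) :
    qShifted a q (n + 1) = qShifted a q n * (1 - a * q ^ n) := by
  simp [qShifted, Finset.prod_range_succ]

theorem qShifted_succ' (a q : ℂ) (n : ℕ) :
    qShifted a q (n + 1) = (1 - a) * qShifted (a * q) q n := by
  simp only [qShifted, Finset.prod_range_succ', pow_zero, mul_one]
  rw [mul_comm]
  congr 1
  exact Finset.prod_congr rfl fun k _ => by ring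

theorem qShifted_add (a q : ℂ) (m n : ℕ) :
    qShifted a q (m + n) = qShifted a q m * qShifted (a * q ^ m) q n := by
  simp only [qShifted, Finset.prod_range_add]
  congr 1
  exact Finset.prod_congr rfl fun k _ => by ring

theorem qShiftedInf_eq_mul (a q : ℂ) (hq : ‖q‖ < 1) (m : ℕ) :
    qShiftedInf a q = qShifted a q m * qShiftedInf (a * q ^ m) q := by
  have h1 := (tendsto_qShifted (a * q ^ m) q hq).const_mul (qShifted a q m)
  have h2 := (tendsto_add_atTop_iff_nat m).2 (tendsto_qShifted a q hq)
  refine tendsto_nhds_unique h2 (h1.congr fun n => ?_)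
  rw [← qShifted_add, add_comm]

/-- The partial products decrease to an infinite product that is nonzero because ∑ r^(i+1)
converges; this limit serves as P. -/
theorem exists_pos_le_prod_one_sub_pow {r : ℝ} (h0 : 0 ≤ r) (h1 : r < 1) :
    ∃ P : ℝ, 0 < P ∧ ∀ n : ℕ, P ≤ ∏ i ∈ Finset.range n, (1 - r ^ (i + 1)) := by
  have hlt : ∀ i : ℕ, r ^ (i + 1) < 1 := fun i => pow_lt_one₀ h0 h1 (by omega)
  have hs : Summable (fun i : ℕ => ‖-(r ^ (i + 1))‖) := by
    simp only [norm_neg, norm_pow, Real.norm_of_nonneg h0]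
    exact (summable_nat_add_iff 1).2 (summable_geometric_of_lt_one h0 h1)
  have hm : Multipliable (fun i : ℕ => 1 + -(r ^ (i + 1))) :=
    multipliable_one_add_of_summable hs
  have hne : ∏' i : ℕ, (1 + -(r ^ (i + 1))) ≠ 0 := by
    apply tprod_one_add_ne_zero_of_summable _ hs
    intro i; have := hlt i; linarith
  have ht := hm.hasProd.tendsto_prod_nat
  simp only [← sub_eq_add_neg] at ht hne
  have hanti : Antitone fun n : ℕ => ∏ i ∈ Finset.range n, (1 - r ^ (i + 1)) := by
    refine antitone_nat_of_succ_le fun n => ?_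
    rw [Finset.prod_range_succ]
    refine mul_le_of_le_one_right (Finset.prod_nonneg fun i _ => ?_) ?_
    · have := hlt i; linarith
    · have := pow_nonneg h0 (n + 1); linarith
  refine ⟨_, lt_of_le_of_ne (ge_of_tendsto' ht fun n => Finset.prod_nonneg fun i _ => ?_)
    hne.symm, fun n => hanti.le_of_tendsto ht n⟩
  have := hlt i; linarith

/-- Each factor satisfies |1 - a b^i| ≥ 1 - r^(i+1). Uniformity in a and b yields bounds independent
of z and covers both bases q and q². -/
theorem exists_pos_le_norm_qShifted {r : ℝ} (h0 : 0 ≤ r) (h1 : r < 1) :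
    ∃ P : ℝ, 0 < P ∧ ∀ a b : ℂ, ‖a‖ ≤ r → ‖b‖ ≤ r →
      (∀ n, P ≤ ‖qShifted a b n‖) ∧ P ≤ ‖qShiftedInf a b‖ := by
  obtain ⟨P, hP, h⟩ := exists_pos_le_prod_one_sub_pow h0 h1
  refine ⟨P, hP, fun a b ha hb => ?_⟩
  have key : ∀ n, P ≤ ‖qShifted a b n‖ := by
    intro n
    refine (h n).trans ?_
    rw [qShifted, norm_prod]
    refine Finset.prod_le_prod (fun i _ => ?_) fun i _ => ?_
    · have := pow_lt_one₀ h0 h1 (n := i + 1) (by omega); linarith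
    · have h2 : ‖a * b ^ i‖ ≤ r ^ (i + 1) := by
        rw [norm_mul, norm_pow, pow_succ']
        gcongr
      have h3 := norm_sub_norm_le (1 : ℂ) (a * b ^ i)
      rw [norm_one] at h3
      linarith
  exact ⟨key, ge_of_tendsto' (tendsto_qShifted a b (hb.trans_lt h1)).norm key⟩

theorem norm_mul_pow_le {q z : ℂ} (hq : ‖q‖ < 1) (hz : ‖z‖ ≤ 1) {k : ℕ} (hk : k ≠ 0) :
    ‖z * q ^ k‖ ≤ ‖q‖ := by
  rw [norm_mul, norm_pow]
  calc ‖z‖ * ‖q‖ ^ k ≤ 1 * ‖q‖ ^ k := by gcongr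
    _ ≤ ‖q‖ := by rw [one_mul]; exact pow_le_of_le_one (norm_nonneg _) hq.le hk

theorem norm_sq_le {q : ℂ} (hq : ‖q‖ < 1) : ‖q ^ 2‖ ≤ ‖q‖ := by
  rw [norm_pow]; exact pow_le_of_le_one (norm_nonneg _) hq.le two_ne_zero

theorem norm_sq_lt_one {q : ℂ} (hq : ‖q‖ < 1) : ‖q ^ 2‖ < 1 := (norm_sq_le hq).trans_lt hq

theorem qShifted_ne_zero {a b : ℂ} (ha : ‖a‖ < 1) (hb : ‖b‖ < 1) (n : ℕ) :
    qShifted a b n ≠ 0 := by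
  obtain ⟨P, hP, h⟩ := exists_pos_le_norm_qShifted (r := max ‖a‖ ‖b‖)
    (le_max_of_le_left (norm_nonneg _)) (max_lt ha hb)
  exact norm_pos_iff.1 (hP.trans_le ((h a b (le_max_left _ _) (le_max_right _ _)).1 n))

theorem qShiftedInf_ne_zero {a b : ℂ} (ha : ‖a‖ < 1) (hb : ‖b‖ < 1) :
    qShiftedInf a b ≠ 0 := by
  obtain ⟨P, hP, h⟩ := exists_pos_le_norm_qShifted (r := max ‖a‖ ‖b‖)
    (le_max_of_le_left (norm_nonneg _)) (max_lt ha hb)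
  exact norm_pos_iff.1 (hP.trans_le (h a b (le_max_left _ _) (le_max_right _ _)).2)

theorem one_sub_ne_zero_of_norm_lt_one {a : ℂ} (ha : ‖a‖ < 1) : 1 - a ≠ 0 := by
  rw [sub_ne_zero]; rintro rfl; simp at ha

/-! ### The two-variable series and their q-difference equations -/

/-- The generating function of the partitions with smallest part `n + 1` whose odd parts are less
than `2 * (n + 1)`; the exponent of `z` is the number of parts minus one. -/
noncomputable def partTerm (q z : ℂ) (n : ℕ) : ℂ :=
  q ^ (n + 1) / (qShifted (z * q ^ (n + 1)) q (n + 2) * qShiftedInf (z * q ^ (2 * n + 4)) (q ^ 2))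

/-- The terms of the two-variable extension of `ω(q)`. -/
noncomputable def omegaTerm (q z : ℂ) (n : ℕ) : ℂ :=
  z ^ n * q ^ (2 * n ^ 2 + 2 * n) /
    (qShifted q (q ^ 2) (n + 1) * qShifted (z * q) (q ^ 2) (n + 1))

theorem exists_norm_partTerm_le {q : ℂ} (hq : ‖q‖ < 1) :
    ∃ C : ℝ, ∀ z n, ‖z‖ ≤ 1 → ‖partTerm q z n‖ ≤ C * ‖q‖ ^ n := by
  obtain ⟨P, hP, h⟩ := exists_pos_le_norm_qShifted (norm_nonneg q) hq
  refine ⟨(P * P)⁻¹, fun z n hz => ?_⟩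
  have e1 := (h _ q (norm_mul_pow_le hq hz n.succ_ne_zero) le_rfl).1 (n + 2)
  have e2 := (h (z * q ^ (2 * n + 4)) _ (norm_mul_pow_le hq hz (by omega)) (norm_sq_le hq)).2
  rw [partTerm, norm_div, norm_mul, norm_pow, div_eq_inv_mul]
  gcongr ?_ * ?_
  · gcongr
  · exact pow_le_pow_of_le_one (norm_nonneg _) hq.le (by omega)

theorem exists_norm_omegaTerm_le {q : ℂ} (hq : ‖q‖ < 1) :
    ∃ C : ℝ, ∀ z n, ‖z‖ ≤ 1 → ‖omegaTerm q z n‖ ≤ C * ‖q‖ ^ n := by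
  obtain ⟨P, hP, h⟩ := exists_pos_le_norm_qShifted (norm_nonneg q) hq
  refine ⟨(P * P)⁻¹, fun z n hz => ?_⟩
  have e1 := (h q _ le_rfl (norm_sq_le hq)).1 (n + 1)
  have e2 := (h (z * q) _ (by simpa using norm_mul_pow_le hq hz one_ne_zero)
    (norm_sq_le hq)).1 (n + 1)
  rw [omegaTerm, norm_div, norm_mul, norm_mul, norm_pow, norm_pow, div_eq_inv_mul]
  gcongr ?_ * ?_
  · gcongr
  · calc ‖z‖ ^ n * ‖q‖ ^ (2 * n ^ 2 + 2 * n)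
        ≤ 1 * ‖q‖ ^ (2 * n ^ 2 + 2 * n) := by
          gcongr; exact pow_le_one₀ (norm_nonneg _) hz
      _ ≤ ‖q‖ ^ n := by
          rw [one_mul]; exact pow_le_pow_of_le_one (norm_nonneg _) hq.le (by nlinarith)

theorem summable_partTerm {q z : ℂ} (hq : ‖q‖ < 1) (hz : ‖z‖ ≤ 1) :
    Summable (partTerm q z) := by
  obtain ⟨C, hC⟩ := exists_norm_partTerm_le hq
  exact .of_norm_bounded ((summable_geometric_of_lt_one (norm_nonneg q) hq).mul_left C)
    fun n => hC z n hz

theorem summable_omegaTerm {q z : ℂ} (hq : ‖q‖ < 1) (hz : ‖z‖ ≤ 1) :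
    Summable (omegaTerm q z) := by
  obtain ⟨C, hC⟩ := exists_norm_omegaTerm_le hq
  exact .of_norm_bounded ((summable_geometric_of_lt_one (norm_nonneg q) hq).mul_left C)
    fun n => hC z n hz

theorem exists_norm_tsum_le {q : ℂ} (hq : ‖q‖ < 1) {f : ℂ → ℕ → ℂ}
    (h : ∃ C : ℝ, ∀ z n, ‖z‖ ≤ 1 → ‖f z n‖ ≤ C * ‖q‖ ^ n) :
    ∃ B : ℝ, ∀ z, ‖z‖ ≤ 1 → ‖∑' n, f z n‖ ≤ B := by
  obtain ⟨C, hC⟩ := h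
  exact ⟨_, fun z hz => tsum_of_norm_bounded
    ((summable_geometric_of_lt_one (norm_nonneg q) hq).mul_left C).hasSum fun n => hC z n hz⟩

/-- The telescoping sequence for `partTerm`. -/
noncomputable def partTail (q z : ℂ) (n : ℕ) : ℂ :=
  1 / (qShifted (z * q ^ (n + 1)) q n * qShiftedInf (z * q ^ (2 * n + 2)) (q ^ 2))

/-- Both factors of the denominator are quotients tending to 1: (zq;q)_{2n} / (zq;q)_n and
(zq²;q²)_∞ / (zq²;q²)_n. -/
theorem tendsto_partTail {q z : ℂ} (hq : ‖q‖ < 1) (hz : ‖z‖ ≤ 1) :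
    Tendsto (partTail q z) atTop (𝓝 1) := by
  have hz1 : ‖z * q‖ < 1 := (by simpa using norm_mul_pow_le hq hz one_ne_zero : _ ≤ _).trans_lt hq
  have hz2 : ‖z * q ^ 2‖ < 1 := (norm_mul_pow_le hq hz two_ne_zero).trans_lt hq
  have n1 := qShiftedInf_ne_zero hz1 hq
  have n2 := qShiftedInf_ne_zero hz2 (norm_sq_lt_one hq)
  have t1 := tendsto_qShifted (z * q) q hq
  have t2 : Tendsto (fun n : ℕ => qShifted (z * q) q (n + n)) atTop
      (𝓝 (qShiftedInf (z * q) q)) := t1.comp (tendsto_atTop_mono (fun n => Nat.le_add_left n n) tendsto_id)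
  have t3 := tendsto_qShifted (z * q ^ 2) (q ^ 2) (norm_sq_lt_one hq)
  have t4 := (t1.div t2 n1).mul (t3.div_const (qShiftedInf (z * q ^ 2) (q ^ 2)))
  rw [div_self n1, div_self n2, one_mul] at t4
  refine t4.congr fun n => ?_
  have m1 := qShifted_ne_zero hz1 hq n
  have m2 := qShifted_ne_zero hz2 (norm_sq_lt_one hq) n
  have m3 := qShifted_ne_zero ((norm_mul_pow_le hq hz n.succ_ne_zero).trans_lt hq) hq n
  have m4 := qShiftedInf_ne_zero ((norm_mul_pow_le hq hz (k := 2 * n + 2) (by omega)).trans_lt hq)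
    (norm_sq_lt_one hq)
  simp only [Pi.div_apply]
  rw [qShifted_add, qShiftedInf_eq_mul (z * q ^ 2) (q ^ 2) (norm_sq_lt_one hq) n, partTail,
    show z * q * q ^ n = z * q ^ (n + 1) by ring,
    show z * q ^ 2 * (q ^ 2) ^ n = z * q ^ (2 * n + 2) by ring]
  field_simp

/-- Over the common denominator of `partTerm q z n`, the numerator is (1 - zq^{n+1}) - (1 -
zq^{2n+1}) = zq^{n+1}(q^n - 1). -/
theorem partTail_succ_sub {q z : ℂ} (hq : ‖q‖ < 1) (hz : ‖z‖ ≤ 1) (n : ℕ) :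
    partTail q z (n + 1) - partTail q z n = z * (q ^ n - 1) * partTerm q z n := by
  have ne : ∀ k : ℕ, k ≠ 0 → 1 - z * q ^ k ≠ 0 := fun k hk =>
    one_sub_ne_zero_of_norm_lt_one ((norm_mul_pow_le hq hz hk).trans_lt hq)
  have h1 := ne (n + 1) (by omega)
  have h2 := ne (2 * n + 2) (by omega)
  have h3 := ne (2 * n + 1) (by omega)
  have hX := qShifted_ne_zero ((norm_mul_pow_le hq hz (k := n + 2) (by omega)).trans_lt hq) hq n
  have hY := qShiftedInf_ne_zero ((norm_mul_pow_le hq hz (k := 2 * n + 4) (by omega)).trans_lt hq)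
    (norm_sq_lt_one hq)
  have e1 : qShifted (z * q ^ (n + 2)) q (n + 1) =
      qShifted (z * q ^ (n + 2)) q n * (1 - z * q ^ (2 * n + 2)) := by
    rw [qShifted_succ]; ring
  have e2 : qShifted (z * q ^ (n + 1)) q (n + 2) =
      (1 - z * q ^ (n + 1)) * (qShifted (z * q ^ (n + 2)) q n * (1 - z * q ^ (2 * n + 2))) := by
    rw [qShifted_succ', ← e1]; ring_nf
  have e3 : qShifted (z * q ^ (n + 1)) q n =
      (1 - z * q ^ (n + 1)) * qShifted (z * q ^ (n + 2)) q n / (1 - z * q ^ (2 * n + 1)) := by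
    rw [eq_div_iff h3]
    have := qShifted_succ (z * q ^ (n + 1)) q n
    rw [qShifted_succ'] at this
    convert this.symm using 2 <;> ring_nf
  have e4 : qShiftedInf (z * q ^ (2 * n + 2)) (q ^ 2) =
      (1 - z * q ^ (2 * n + 2)) * qShiftedInf (z * q ^ (2 * n + 4)) (q ^ 2) := by
    rw [qShiftedInf_eq_mul _ _ (norm_sq_lt_one hq) 1]
    simp only [qShifted, Finset.prod_range_one, pow_zero, mul_one, pow_one]
    ring_nf
  rw [partTail, partTail, partTerm, e4, e3, e2, show n + 1 + 1 = n + 2 by ring, e1,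
    show 2 * (n + 1) + 2 = 2 * n + 4 by ring]
  field_simp
  ring

theorem mul_partTerm_mul_sq {q z : ℂ} (hq : ‖q‖ < 1) (hz : ‖z‖ ≤ 1) (n : ℕ) :
    q * partTerm q (z * q ^ 2) n = (1 - z * q ^ (n + 2)) * partTerm q z (n + 1) := by
  have h1 : 1 - z * q ^ (n + 2) ≠ 0 :=
    one_sub_ne_zero_of_norm_lt_one ((norm_mul_pow_le hq hz (by omega)).trans_lt hq)
  rw [partTerm, partTerm, qShifted_succ' (z * q ^ (n + 1 + 1)),
    show z * q ^ 2 * q ^ (n + 1) = z * q ^ (n + 1 + 1) * q by ring,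
    show z * q ^ 2 * q ^ (2 * n + 4) = z * q ^ (2 * (n + 1) + 4) by ring,
    mul_assoc (1 - z * q ^ (n + 1 + 1)), ← div_div, ← mul_div_assoc, ← mul_div_assoc]
  field_simp
  ring

/-- Pairing term n + 1 at z with term n at zq² leaves the coefficient (1 - zq) - (1 - zq^{n+2}) =
qz(q^{n+1} - 1), which is q times a difference of consecutive `partTail` values. The unpaired term 0
contributes q times `partTail q z 1`, so only the limit of `partTail` survives. -/
theorem one_sub_mul_tsum_partTerm {q z : ℂ} (hq : ‖q‖ < 1) (hz : ‖z‖ ≤ 1) :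
    (1 - z * q) * ∑' n, partTerm q z n = q + q * ∑' n, partTerm q (z * q ^ 2) n := by
  have hz2 : ‖z * q ^ 2‖ ≤ 1 := (norm_mul_pow_le hq hz two_ne_zero).trans hq.le
  have partial_sum : ∀ M : ℕ, (1 - z * q) * ∑ n ∈ Finset.range (M + 1), partTerm q z n =
      q * partTail q z (M + 1) + q * ∑ n ∈ Finset.range M, partTerm q (z * q ^ 2) n := by
    intro M
    induction M with
    | zero =>
      have h1 : 1 - z * q ≠ 0 := by
        simpa using one_sub_ne_zero_of_norm_lt_one
          ((norm_mul_pow_le hq hz one_ne_zero).trans_lt hq)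
      have e : qShifted (z * q) q 2 = (1 - z * q) * qShifted (z * q ^ 2) q 1 := by
        rw [qShifted_succ', mul_assoc, ← sq]
      simp only [zero_add, Finset.sum_range_one, Finset.sum_range_zero, partTerm, partTail,
        mul_zero, mul_one, add_zero, one_add_one_eq_two, pow_one, e]
      field_simp
    | succ M ih =>
      rw [Finset.sum_range_succ, mul_add, ih, Finset.sum_range_succ, mul_add q,
        mul_partTerm_mul_sq hq hz]
      linear_combination -q * partTail_succ_sub hq hz (M + 1)
  have l1 := ((tendsto_add_atTop_iff_nat 1).2
    (summable_partTerm hq hz).hasSum.tendsto_sum_nat).const_mul (1 - z * q)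
  have l2 := (((tendsto_add_atTop_iff_nat 1).2 (tendsto_partTail hq hz)).const_mul q).add
    ((summable_partTerm hq hz2).hasSum.tendsto_sum_nat.const_mul q)
  rw [mul_one] at l2
  exact tendsto_nhds_unique l1 (l2.congr fun M => (partial_sum M).symm)

theorem omegaTerm_sub {q z : ℂ} (hq : ‖q‖ < 1) (hz : ‖z‖ ≤ 1) (n : ℕ) :
    (1 - z * q) * omegaTerm q z n - q * omegaTerm q (z * q ^ 2) n =
      (1 - z * q) * ((1 - q ^ (2 * n + 1)) * omegaTerm q z n -
        (1 - q ^ (2 * (n + 1) + 1)) * omegaTerm q z (n + 1)) := by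
  have hz1 : ‖z * q‖ < 1 := (by simpa using norm_mul_pow_le hq hz one_ne_zero : _ ≤ _).trans_lt hq
  have h1 : 1 - z * q ≠ 0 := one_sub_ne_zero_of_norm_lt_one hz1
  have h2 : 1 - z * q ^ (2 * n + 3) ≠ 0 :=
    one_sub_ne_zero_of_norm_lt_one ((norm_mul_pow_le hq hz (by omega)).trans_lt hq)
  have h3 : 1 - q ^ (2 * n + 3) ≠ 0 := by
    simpa using one_sub_ne_zero_of_norm_lt_one
      ((norm_mul_pow_le hq norm_one.le (k := 2 * n + 3) (by omega)).trans_lt hq)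
  have hX := qShifted_ne_zero hq (norm_sq_lt_one hq) (n + 1)
  have hY := qShifted_ne_zero hz1 (norm_sq_lt_one hq) (n + 1)
  have e1 : qShifted q (q ^ 2) (n + 1 + 1) =
      qShifted q (q ^ 2) (n + 1) * (1 - q ^ (2 * n + 3)) := by
    rw [qShifted_succ]; ring
  have e2 : qShifted (z * q) (q ^ 2) (n + 1 + 1) =
      qShifted (z * q) (q ^ 2) (n + 1) * (1 - z * q ^ (2 * n + 3)) := by
    rw [qShifted_succ]; ring
  have e3 : qShifted (z * q ^ 2 * q) (q ^ 2) (n + 1) =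
      qShifted (z * q) (q ^ 2) (n + 1) * (1 - z * q ^ (2 * n + 3)) / (1 - z * q) := by
    rw [eq_div_iff h1, ← e2, qShifted_succ' (z * q) _ (n + 1), mul_right_comm, mul_comm]
  rw [omegaTerm, omegaTerm, omegaTerm, e3, e2, e1, show 2 * (n + 1) + 1 = 2 * n + 3 by ring]
  field_simp
  ring

/-- By `omegaTerm_sub` the difference of the two series telescopes; its initial value is 1 and its
tail vanishes. -/
theorem one_sub_mul_tsum_omegaTerm {q z : ℂ} (hq : ‖q‖ < 1) (hz : ‖z‖ ≤ 1) :
    (1 - z * q) * ∑' n, omegaTerm q z n = 1 + q * ∑' n, omegaTerm q (z * q ^ 2) n := by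
  have hz1 : ‖z * q‖ < 1 := (by simpa using norm_mul_pow_le hq hz one_ne_zero : _ ≤ _).trans_lt hq
  have hz2 : ‖z * q ^ 2‖ ≤ 1 := (norm_mul_pow_le hq hz two_ne_zero).trans hq.le
  have s1 := summable_omegaTerm hq hz
  have s2 := summable_omegaTerm hq hz2
  have l1 := ((s1.hasSum.mul_left (1 - z * q)).sub (s2.hasSum.mul_left q)).tendsto_sum_nat
  simp only [omegaTerm_sub hq hz, ← Finset.mul_sum, Finset.sum_range_sub'] at l1
  have l2 : Tendsto (fun n : ℕ => (1 - q ^ (2 * n + 1)) * omegaTerm q z n) atTop (𝓝 0) := by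
    have hpow : Tendsto (fun n : ℕ => q ^ (2 * n + 1)) atTop (𝓝 0) :=
      (tendsto_pow_atTop_nhds_zero_of_norm_lt_one hq).comp
        (tendsto_atTop_mono (fun n => by omega : ∀ n : ℕ, n ≤ 2 * n + 1) tendsto_id)
    simpa using (hpow.const_sub 1).mul s1.tendsto_atTop_zero
  have h0 : (1 - z * q) * ((1 - q ^ (2 * 0 + 1)) * omegaTerm q z 0 - 0) = 1 := by
    have h1 : 1 - z * q ≠ 0 := one_sub_ne_zero_of_norm_lt_one hz1
    have h2 : 1 - q ≠ 0 := one_sub_ne_zero_of_norm_lt_one hq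
    simp [omegaTerm, qShifted]
    field_simp
  have l3 := (l2.const_sub ((1 - q ^ (2 * 0 + 1)) * omegaTerm q z 0)).const_mul (1 - z * q)
  rw [h0] at l3
  linear_combination tendsto_nhds_unique l1 l3

theorem tsum_partTerm_eq_tsum_omegaTerm {q : ℂ} (hq : ‖q‖ < 1) :
    ∑' n, partTerm q 1 n = q * ∑' n, omegaTerm q 1 n := by
  obtain ⟨P, hP, h⟩ := exists_pos_le_norm_qShifted (norm_nonneg q) hq
  obtain ⟨B₁, hB₁⟩ := exists_norm_tsum_le hq (exists_norm_partTerm_le hq)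
  obtain ⟨B₂, hB₂⟩ := exists_norm_tsum_le hq (exists_norm_omegaTerm_le hq)
  set D : ℂ → ℂ := fun z => ∑' n, partTerm q z n - q * ∑' n, omegaTerm q z n with hD
  have hzm : ∀ m : ℕ, ‖q ^ (2 * m)‖ ≤ 1 := fun m => by
    rw [norm_pow]; exact pow_le_one₀ (norm_nonneg _) hq.le
  have iter : ∀ m : ℕ, qShifted q (q ^ 2) m * D 1 = q ^ m * D (q ^ (2 * m)) := by
    intro m
    induction m with
    | zero => simp [qShifted]
    | succ m ih =>
      have e1 := one_sub_mul_tsum_partTerm hq (hzm m)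
      have e2 := one_sub_mul_tsum_omegaTerm hq (hzm m)
      have e3 : (1 - q ^ (2 * m) * q) * D (q ^ (2 * m)) = q * D (q ^ (2 * m) * q ^ 2) := by
        simp only [hD]; linear_combination e1 - q * e2
      rw [qShifted_succ, show q ^ (2 * (m + 1)) = q ^ (2 * m) * q ^ 2 by ring]
      linear_combination (1 - q ^ (2 * m) * q) * ih + q ^ m * e3
  have bound : ∀ m : ℕ, P * ‖D 1‖ ≤ ‖q‖ ^ m * (B₁ + ‖q‖ * B₂) := by
    intro m
    calc P * ‖D 1‖ ≤ ‖qShifted q (q ^ 2) m‖ * ‖D 1‖ := by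
          gcongr; exact (h q _ le_rfl (norm_sq_le hq)).1 m
      _ = ‖q‖ ^ m * ‖D (q ^ (2 * m))‖ := by rw [← norm_mul, iter, norm_mul, norm_pow]
      _ ≤ _ := by
          gcongr
          refine (norm_sub_le _ _).trans (add_le_add (hB₁ _ (hzm m)) ?_)
          rw [norm_mul]
          gcongr
          exact hB₂ _ (hzm m)
  have lim := (tendsto_pow_atTop_nhds_zero_of_lt_one (norm_nonneg q) hq).mul_const (B₁ + ‖q‖ * B₂)
  rw [zero_mul] at lim
  have h0 : P * ‖D 1‖ ≤ 0 := ge_of_tendsto' lim bound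
  have h1 : ‖D 1‖ ≤ 0 := nonpos_of_mul_nonpos_right h0 hP
  exact sub_eq_zero.1 (norm_le_zero_iff.1 h1)

/-! ### Generating functions of multisets with prescribed parts -/

/-- The multisets all of whose elements lie in `A`. -/
def partsIn (A : Set ℕ) : Set (Multiset ℕ) := {m | ∀ i ∈ m, i ∈ A}

theorem partsIn_mono {A B : Set ℕ} (h : A ⊆ B) : partsIn A ⊆ partsIn B :=
  fun _ hm i hi => h (hm i hi)

/-- A multiset in `A ∪ {a}`, `a ∉ A`, is a multiset in `A` with some copies of `a` added. -/
def partsInInsertEquiv {A : Finset ℕ} {a : ℕ} (ha : a ∉ A) :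
    ℕ × partsIn (A : Set ℕ) ≃ partsIn ((insert a A : Finset ℕ) : Set ℕ) where
  toFun p := ⟨Multiset.replicate p.1 a + p.2.1, fun i hi => by
    rcases Multiset.mem_add.1 hi with h | h
    · simp [Multiset.eq_of_mem_replicate h]
    · have := p.2.2 i h
      simp_all⟩
  invFun m := (m.1.count a, ⟨m.1.filter (¬ · = a), fun i hi => by
    have := m.2 i (Multiset.mem_of_mem_filter hi)
    have h := Multiset.of_mem_filter hi
    simpa [h] using this⟩)
  left_inv p := by
    have h : a ∉ p.2.1 := fun h => ha (by simpa using p.2.2 a h)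
    ext1
    · simp [Multiset.count_eq_zero_of_notMem h]
    · ext1
      simp only [Multiset.filter_add]
      rw [Multiset.filter_eq_nil.2, zero_add, Multiset.filter_eq_self]
      · rintro i hi rfl; exact h hi
      · intro i hi; simp [Multiset.eq_of_mem_replicate hi]
  right_inv m := by
    ext1
    simp only [← Multiset.filter_eq', Multiset.filter_add_not]

/-- Each new part a contributes a geometric series in x^a. Absolute summability is carried through
the induction to justify multiplying the series. -/
theorem hasSum_partsIn_finset {K : Type*} [NormedField K] [CompleteSpace K] {x : K}
    (hx : ‖x‖ < 1) (A : Finset ℕ) (hA : 0 ∉ A) :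
    Summable (fun m : partsIn (A : Set ℕ) => ‖x ^ m.1.sum‖) ∧
      HasSum (fun m : partsIn (A : Set ℕ) => x ^ m.1.sum) (∏ a ∈ A, (1 - x ^ a)⁻¹) := by
  induction A using Finset.induction_on with
  | empty =>
    let hu : Unique (partsIn ((∅ : Finset ℕ) : Set ℕ)) :=
      { default := ⟨0, fun i hi => by simp at hi⟩
        uniq := fun m => Subtype.ext <| Multiset.eq_zero_of_forall_notMem fun i hi => by
          simpa using m.2 i hi }
    have h0 : (default : partsIn ((∅ : Finset ℕ) : Set ℕ)).1 = 0 := rfl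
    refine ⟨(hasSum_unique _).summable, ?_⟩
    simpa [h0] using hasSum_unique fun m : partsIn ((∅ : Finset ℕ) : Set ℕ) => x ^ m.1.sum
  | insert a A ha ih =>
    simp only [Finset.mem_insert, not_or] at hA
    obtain ⟨s1, s2⟩ := ih hA.2
    have hxa : ‖x ^ a‖ < 1 := by
      rw [norm_pow]; exact pow_lt_one₀ (norm_nonneg _) hx (Ne.symm hA.1)
    have g1 : Summable fun k : ℕ => ‖(x ^ a) ^ k‖ := by
      simpa only [norm_pow] using summable_geometric_of_lt_one (norm_nonneg _) hxa
    have key : ∀ p : ℕ × partsIn (A : Set ℕ),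
        x ^ ((partsInInsertEquiv ha) p).1.sum = (x ^ a) ^ p.1 * x ^ p.2.1.sum := fun p => by
      simp [partsInInsertEquiv, pow_add, pow_mul, mul_comm]
    rw [← (partsInInsertEquiv ha).summable_iff, ← (partsInInsertEquiv ha).hasSum_iff]
    simp only [Function.comp_def, key]
    refine ⟨?_, ?_⟩
    · simp only [norm_mul]
      exact Summable.mul_of_nonneg (f := fun k : ℕ => ‖(x ^ a) ^ k‖)
        (g := fun m : partsIn (A : Set ℕ) => ‖x ^ m.1.sum‖) g1 s1
        (fun _ => norm_nonneg _) fun _ => norm_nonneg _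
    · rw [Finset.prod_insert ha]
      have s3 := summable_mul_of_summable_norm (f := fun k : ℕ => (x ^ a) ^ k)
        (g := fun m : partsIn (A : Set ℕ) => x ^ m.1.sum) g1 s1
      exact HasSum.mul (f := fun k : ℕ => (x ^ a) ^ k)
        (g := fun m : partsIn (A : Set ℕ) => x ^ m.1.sum)
        (hasSum_geometric_of_norm_lt_one hxa) s2 s3

theorem summable_partsIn_compl_zero {r : ℝ} (h0 : 0 ≤ r) (h1 : r < 1) :
    Summable (fun m : partsIn {0}ᶜ => r ^ m.1.sum) := by
  obtain ⟨P, hP, h⟩ := exists_pos_le_prod_one_sub_pow h0 h1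
  refine summable_of_sum_le (c := P⁻¹) (fun m => pow_nonneg h0 _) fun u => ?_
  -- Finitely many multisets use only parts from {1, ..., N}, so their sum is at most a finite Euler
  -- product, bounded by P⁻¹ independently of N.
  obtain ⟨N, hN⟩ : ∃ N, ∀ m ∈ u, ∀ i ∈ m.1, i ≤ N := by
    refine ⟨u.sup fun m => m.1.sum, fun m hm i hi => ?_⟩
    exact (Multiset.le_sum_of_mem hi).trans
      (Finset.le_sup (f := fun m : partsIn {0}ᶜ => m.1.sum) hm)
  set A : Finset ℕ := (Finset.range N).image (· + 1)
  have hA : 0 ∉ A := by simp [A]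
  have hs := (hasSum_partsIn_finset (x := r) (by rwa [Real.norm_of_nonneg h0]) A hA).2
  replace hs := (hasSum_subtype_iff_indicator (f := fun m : Multiset ℕ => r ^ m.sum)).1 hs
  calc _ = ∑ m ∈ u.map (Function.Embedding.subtype _), r ^ m.sum := by
        rw [Finset.sum_map]; rfl
    _ = ∑ m ∈ u.map (Function.Embedding.subtype _),
        (partsIn (A : Set ℕ)).indicator (fun m => r ^ m.sum) m := by
        refine Finset.sum_congr rfl fun m hm => ?_
        obtain ⟨m, hu, rfl⟩ := Finset.mem_map.1 hm
        have hmem : m.1 ∈ partsIn (A : Set ℕ) := fun i hi => by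
          have h2 : i ≠ 0 := m.2 i hi
          have h3 := hN m hu i hi
          simp only [A, Finset.coe_image, Finset.coe_range, Set.mem_image, Set.mem_Iio]
          exact ⟨i - 1, by omega, by omega⟩
        exact (Set.indicator_of_mem hmem fun m => r ^ m.sum).symm
    _ ≤ ∏ a ∈ A, (1 - r ^ a)⁻¹ :=
        sum_le_hasSum _ (fun m _ => Set.indicator_nonneg (fun m _ => pow_nonneg h0 _) _) hs
    _ ≤ P⁻¹ := by
        rw [Finset.prod_inv_distrib, Finset.prod_image (fun _ _ _ _ => Nat.succ.inj)]
        exact inv_anti₀ hP (h N)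

theorem summable_pow_sum {q : ℂ} (hq : ‖q‖ < 1) {S : Set (Multiset ℕ)}
    (hS : S ⊆ partsIn {0}ᶜ) : Summable (fun m : S => q ^ m.1.sum) := by
  refine .of_norm ?_
  simp only [norm_pow]
  exact Summable.comp_injective (i := Set.inclusion hS)
    (summable_partsIn_compl_zero (norm_nonneg q) hq) (Set.inclusion_injective hS)

/-- A multiset is finite, so one with parts in the union eventually has all its parts in A N.
Dominated convergence then applies, with the sum over all multisets of positive parts as majorant.
-/
theorem tsum_partsIn_iUnion {q : ℂ} (hq : ‖q‖ < 1) {A : ℕ → Finset ℕ} (hmono : Monotone A)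
    (hA : ∀ N, 0 ∉ A N) {L : ℂ}
    (hL : Tendsto (fun N => ∏ a ∈ A N, (1 - q ^ a)⁻¹) atTop (𝓝 L)) :
    ∑' m : partsIn (⋃ N, (A N : Set ℕ)), q ^ m.1.sum = L := by
  have hlim : Tendsto
      (fun N => ∑' m, (partsIn (A N : Set ℕ)).indicator (fun m => q ^ m.sum) m) atTop
      (𝓝 (∑' m, (partsIn (⋃ N, (A N : Set ℕ))).indicator (fun m => q ^ m.sum) m)) := by
    refine tendsto_tsum_of_dominated_convergence
      (bound := (partsIn {0}ᶜ).indicator fun m => ‖q‖ ^ m.sum) ?_ (fun m => ?_)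
      (.of_forall fun N m => ?_)
    · exact summable_subtype_iff_indicator.1 (summable_partsIn_compl_zero (norm_nonneg q) hq)
    · by_cases hm : m ∈ partsIn (⋃ N, (A N : Set ℕ))
      · rw [Set.indicator_of_mem hm]
        have ev : ∀ᶠ N in atTop, m ∈ partsIn (A N : Set ℕ) := by
          have : ∀ i ∈ m.toFinset, ∀ᶠ N in atTop, i ∈ A N := fun i hi => by
            obtain ⟨N, hN⟩ := Set.mem_iUnion.1 (hm i (Multiset.mem_toFinset.1 hi))
            exact (eventually_ge_atTop N).mono fun M hM => hmono hM hN
          filter_upwards [(Filter.eventually_all_finset _).2 this] with N hN i hi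
          exact hN i (Multiset.mem_toFinset.2 hi)
        exact tendsto_const_nhds.congr' (ev.mono fun N hN => (Set.indicator_of_mem hN _).symm)
      · rw [Set.indicator_of_notMem hm]
        refine tendsto_const_nhds.congr fun N => (Set.indicator_of_notMem (fun h => hm ?_) _).symm
        exact partsIn_mono (Set.subset_iUnion (fun N => (A N : Set ℕ)) N) h
    · rw [norm_indicator_eq_indicator_norm]
      simp only [norm_pow]
      refine Set.indicator_le_indicator_of_subset (partsIn_mono ?_)
        (fun m => pow_nonneg (norm_nonneg _) _) m
      rintro i hi rfl
      exact hA N hi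
  rw [tsum_subtype _ fun m : Multiset ℕ => q ^ m.sum]
  refine tendsto_nhds_unique hlim (hL.congr fun N => ?_)
  rw [← tsum_subtype _ fun m : Multiset ℕ => q ^ m.sum, (hasSum_partsIn_finset hq (A N) (hA N)).2.tsum_eq]

/-- The parts allowed in a partition counted by `pOmega` with smallest part `s`. -/
def allowedParts (s : ℕ) : Set ℕ := {i | s ≤ i ∧ (Odd i → i < 2 * s)}

theorem qShifted_pow_eq_prod (q : ℂ) (j d n : ℕ) :
    qShifted (q ^ j) (q ^ d) n = ∏ k ∈ Finset.range n, (1 - q ^ (j + d * k)) := by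
  simp only [qShifted, pow_add, pow_mul]

theorem tsum_partsIn_allowedParts {q : ℂ} (hq : ‖q‖ < 1) {s : ℕ} (hs : s ≠ 0) :
    ∑' m : partsIn (allowedParts s), q ^ m.1.sum =
      (qShifted (q ^ s) q (s + 1) * qShiftedInf (q ^ (2 * s + 2)) (q ^ 2))⁻¹ := by
  -- The block s, ..., 2s gives (q^s;q)_{s+1}; above 2s only even parts are allowed, and these give
  -- the factors in base q².
  set A : ℕ → Finset ℕ := fun N =>
    (Finset.range (s + 1)).image (s + ·) ∪ (Finset.range N).image (2 * s + 2 + 2 * ·) with hAdef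
  have hunion : allowedParts s = ⋃ N, (A N : Set ℕ) := by
    ext i
    simp only [allowedParts, Set.mem_ofPred_eq, Set.mem_iUnion, hAdef, Finset.mem_coe,
      Finset.mem_union, Finset.mem_image, Finset.mem_range]
    constructor
    · rintro ⟨h1, h2⟩
      by_cases h : i ≤ 2 * s
      · exact ⟨0, .inl ⟨i - s, by omega, by omega⟩⟩
      · have he : ¬ Odd i := fun ho => by have := h2 ho; omega
        rw [Nat.odd_iff] at he
        exact ⟨i, .inr ⟨(i - (2 * s + 2)) / 2, by omega, by omega⟩⟩
    · rintro ⟨N, ⟨k, hk, rfl⟩ | ⟨k, hk, rfl⟩⟩ <;> refine ⟨by omega, ?_⟩ <;> rw [Nat.odd_iff] <;>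
        omega
  rw [hunion]
  refine tsum_partsIn_iUnion hq (fun M N hMN => ?_) (fun N => ?_) ?_
  · exact Finset.union_subset_union_right
      (Finset.image_subset_image (Finset.range_subset_range.2 hMN))
  · simp [hAdef, hs]
  · have hpow : ∀ k : ℕ, k ≠ 0 → ‖q ^ k‖ < 1 := fun k hk => by
      rw [norm_pow]; exact pow_lt_one₀ (norm_nonneg _) hq hk
    have hne : qShifted (q ^ s) q (s + 1) * qShiftedInf (q ^ (2 * s + 2)) (q ^ 2) ≠ 0 :=
      mul_ne_zero (qShifted_ne_zero (hpow s hs) hq _)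
        (qShiftedInf_ne_zero (hpow _ (by omega)) (norm_sq_lt_one hq))
    refine (((tendsto_qShifted (q ^ (2 * s + 2)) (q ^ 2) (norm_sq_lt_one hq)).const_mul
      (qShifted (q ^ s) q (s + 1))).inv₀ hne).congr fun N => ?_
    have hdisj : Disjoint ((Finset.range (s + 1)).image (s + ·))
        ((Finset.range N).image (2 * s + 2 + 2 * ·)) := by
      simp only [Finset.disjoint_left, Finset.mem_image, Finset.mem_range]
      rintro _ ⟨k, hk, rfl⟩ ⟨l, hl, h⟩
      omega
    rw [Finset.prod_inv_distrib, Finset.prod_union hdisj,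
      Finset.prod_image (fun a _ b _ h => by simpa using h),
      Finset.prod_image (fun a _ b _ h => by simpa using h), qShifted_pow_eq_prod]
    have := qShifted_pow_eq_prod q s 1 (s + 1)
    simp only [pow_one, one_mul] at this
    rw [this]

/-! ### Admissible partitions, grouped by size and by smallest part -/

/-- The smallest element of a multiset of natural numbers. -/
noncomputable def Multiset.least (m : Multiset ℕ) : ℕ := sInf {j | j ∈ m}

theorem Multiset.least_mem {m : Multiset ℕ} (h : m ≠ 0) : m.least ∈ m :=
  Nat.sInf_mem (Multiset.exists_mem_of_ne_zero h)

theorem Multiset.least_le {m : Multiset ℕ} {i : ℕ} (h : i ∈ m) : m.least ≤ i :=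
  Nat.sInf_le h

/-- The nonempty partitions in which each odd part is less than twice the smallest part. -/
def omegaPartitions : Set (Multiset ℕ) :=
  {m | 0 ∉ m ∧ m ≠ 0 ∧ ∀ i ∈ m, Odd i → i < 2 * m.least}

/-- The size of a nonempty partition. -/
def omegaPartitions.size (m : omegaPartitions) : ℕ+ :=
  ⟨m.1.sum, Nat.pos_of_ne_zero fun h => by
    obtain ⟨i, hi⟩ := Multiset.exists_mem_of_ne_zero m.2.2.1
    have h0 : i = 0 := by have := Multiset.le_sum_of_mem hi; omega
    exact m.2.1 (h0 ▸ hi)⟩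

/-- The smallest part of a nonempty partition. -/
noncomputable def omegaPartitions.smallest (m : omegaPartitions) : ℕ+ :=
  ⟨m.1.least, Nat.pos_of_ne_zero fun h => m.2.1 (h ▸ Multiset.least_mem m.2.2.1)⟩

/-- The elements of `omegaPartitions` of size `n` are the partitions counted by `pOmega n`. -/
def omegaPartitions.sizeFiberEquiv (n : ℕ+) :
    {p : (n : ℕ).Partition // ∀ i ∈ p.parts, Odd i → i < 2 * p.smallestPart} ≃
      omegaPartitions.size ⁻¹' {n} where
  toFun p := ⟨⟨p.1.parts, fun h => absurd (p.1.parts_pos h) (lt_irrefl 0), fun h => n.ne_zero <| by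
      rw [← p.1.parts_sum, h, Multiset.sum_zero], p.2⟩, PNat.eq p.1.parts_sum⟩
  invFun m := ⟨⟨m.1.1, fun {i} hi => Nat.pos_of_ne_zero fun h => m.1.2.1 (h ▸ hi),
    congrArg PNat.val m.2⟩, m.1.2.2.2⟩
  left_inv _ := rfl
  right_inv _ := rfl

theorem cons_mem_omegaPartitions {s : ℕ+} (m : partsIn (allowedParts s)) :
    ((s : ℕ) ::ₘ m.1).least = s ∧ (s : ℕ) ::ₘ m.1 ∈ omegaPartitions := by
  have hs := s.pos
  have hle : ∀ i ∈ (s : ℕ) ::ₘ m.1, (s : ℕ) ≤ i := fun i hi => by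
    rcases Multiset.mem_cons.1 hi with rfl | hi
    · exact le_rfl
    · exact (m.2 i hi).1
  have hl : ((s : ℕ) ::ₘ m.1).least = s :=
    le_antisymm (Multiset.least_le (Multiset.mem_cons_self _ _))
      (hle _ (Multiset.least_mem (Multiset.cons_ne_zero)))
  refine ⟨hl, fun h => by have := hle 0 h; omega, Multiset.cons_ne_zero, fun i hi ho => ?_⟩
  rw [hl]
  rcases Multiset.mem_cons.1 hi with rfl | hi
  · omega
  · exact (m.2 i hi).2 ho

/-- The elements of `omegaPartitions` with smallest part `s` arise by adding the part `s` to a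
multiset of allowed parts. -/
def omegaPartitions.smallestFiberEquiv (s : ℕ+) :
    partsIn (allowedParts s) ≃ omegaPartitions.smallest ⁻¹' {s} where
  toFun m := ⟨⟨(s : ℕ) ::ₘ m.1, (cons_mem_omegaPartitions m).2⟩,
    PNat.eq (cons_mem_omegaPartitions m).1⟩
  invFun m := ⟨m.1.1.erase s, fun i hi => by
    have hs : m.1.1.least = s := congrArg PNat.val m.2
    have hi' := Multiset.mem_of_mem_erase hi
    exact ⟨hs ▸ Multiset.least_le hi', hs ▸ m.1.2.2.2 i hi'⟩⟩
  left_inv m := by simp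
  right_inv m := by
    have hs : m.1.1.least = s := congrArg PNat.val m.2
    have : (s : ℕ) ∈ m.1.1 := hs ▸ Multiset.least_mem m.1.2.2.1
    ext1; ext1
    exact Multiset.cons_erase this

theorem summable_omegaPartitions {q : ℂ} (hq : ‖q‖ < 1) :
    Summable (fun m : omegaPartitions => q ^ m.1.sum) :=
  summable_pow_sum hq fun _ hm _ hi h => hm.1 (h ▸ hi)

theorem hasSum_pOmega {q : ℂ} (hq : ‖q‖ < 1) :
    HasSum (fun n : ℕ+ => (pOmega n : ℂ) * q ^ (n : ℕ))
      (∑' m : omegaPartitions, q ^ m.1.sum) := by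
  have hfib (n : ℕ+) : (pOmega n : ℂ) * q ^ (n : ℕ) =
      ∑' m : omegaPartitions.size ⁻¹' {n}, q ^ m.1.1.sum := by
    have h : ∀ m : omegaPartitions.size ⁻¹' {n}, q ^ m.1.1.sum = q ^ (n : ℕ) := fun m =>
      congrArg (q ^ ·) (congrArg PNat.val m.2)
    rw [tsum_congr h, tsum_const, pOmega, Nat.card_congr (omegaPartitions.sizeFiberEquiv n),
      nsmul_eq_mul]
  rw [funext hfib]
  exact (summable_omegaPartitions hq).hasSum.tsum_fiberwise omegaPartitions.size

theorem hasSum_smallest {q : ℂ} (hq : ‖q‖ < 1) :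
    HasSum (fun s : ℕ+ => q ^ (s : ℕ) /
      (qShifted (q ^ (s : ℕ)) q (s + 1) * qShiftedInf (q ^ (2 * (s : ℕ) + 2)) (q ^ 2)))
      (∑' m : omegaPartitions, q ^ m.1.sum) := by
  have hfib (s : ℕ+) : q ^ (s : ℕ) /
      (qShifted (q ^ (s : ℕ)) q (s + 1) * qShiftedInf (q ^ (2 * (s : ℕ) + 2)) (q ^ 2)) =
      ∑' m : omegaPartitions.smallest ⁻¹' {s}, q ^ m.1.1.sum := by
    rw [← (omegaPartitions.smallestFiberEquiv s).tsum_eq, div_eq_mul_inv,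
      ← tsum_partsIn_allowedParts hq s.ne_zero, ← tsum_mul_left]
    refine tsum_congr fun m => ?_
    simp [omegaPartitions.smallestFiberEquiv, pow_add]
  rw [funext hfib]
  exact (summable_omegaPartitions hq).hasSum.tsum_fiberwise omegaPartitions.smallest

theorem theorem3p1 (q : ℂ) (hq : ‖q‖ < 1) :
    -- the series defining `ω(q)` converges
    Summable (fun n : ℕ => q ^ (2 * n ^ 2 + 2 * n) / qShifted q (q ^ 2) (n + 1) ^ 2) ∧
    -- no denominator vanishes
    (∀ n : ℕ, qShifted q (q ^ 2) (n + 1) ≠ 0) ∧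
    (∀ n : ℕ+, (1 - q ^ (n : ℕ)) * qShifted (q ^ ((n : ℕ) + 1)) q n *
      qShiftedInf (q ^ (2 * (n : ℕ) + 2)) (q ^ 2) ≠ 0) ∧
    -- the `q`-series identity
    HasSum (fun n : ℕ+ => q ^ (n : ℕ) /
        ((1 - q ^ (n : ℕ)) * qShifted (q ^ ((n : ℕ) + 1)) q n *
          qShiftedInf (q ^ (2 * (n : ℕ) + 2)) (q ^ 2)))
      (q * mockOmega q) ∧
    -- the generating function of the partitions
    HasSum (fun n : ℕ+ => (pOmega n : ℂ) * q ^ (n : ℕ)) (q * mockOmega q) := by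
  have hpow : ∀ k : ℕ, k ≠ 0 → ‖q ^ k‖ < 1 := fun k hk => by
    rw [norm_pow]; exact pow_lt_one₀ (norm_nonneg _) hq hk
  have homega : omegaTerm q 1 =
      fun n : ℕ => q ^ (2 * n ^ 2 + 2 * n) / qShifted q (q ^ 2) (n + 1) ^ 2 := by
    ext n; simp [omegaTerm, sq]
  have hden : ∀ n : ℕ+, (1 - q ^ (n : ℕ)) * qShifted (q ^ ((n : ℕ) + 1)) q n =
      qShifted (q ^ (n : ℕ)) q (n + 1) := fun n => by rw [qShifted_succ', pow_succ]
  have hsmall := hasSum_smallest hq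
  have hpart : HasSum (fun s : ℕ+ => q ^ (s : ℕ) /
      (qShifted (q ^ (s : ℕ)) q (s + 1) * qShiftedInf (q ^ (2 * (s : ℕ) + 2)) (q ^ 2)))
      (q * mockOmega q) := by
    rw [mockOmega, ← homega, ← tsum_partTerm_eq_tsum_omegaTerm hq,
      ← Equiv.pnatEquivNat.symm.hasSum_iff]
    refine (congrArg (HasSum · _) (funext fun n => ?_)).mpr (summable_partTerm hq norm_one.le).hasSum
    simp [partTerm, mul_add]
  refine ⟨homega ▸ summable_omegaTerm hq norm_one.le, fun n => ?_, fun n => ?_, ?_, ?_⟩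
  · exact qShifted_ne_zero hq (norm_sq_lt_one hq) _
  · rw [hden]
    exact mul_ne_zero (qShifted_ne_zero (hpow n n.ne_zero) hq _)
      (qShiftedInf_ne_zero (hpow _ (by omega)) (norm_sq_lt_one hq))
  · simpa only [hden] using hpart
  -- The smallest-part series has both qω(q) and the sum over all admissible partitions as its sum,
  -- so the two agree.
  · exact hpart.unique hsmall ▸ hasSum_pOmega hq
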